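/- Let $\Gamma$ be a finite alphabet. Let $\mathcal{S}r=\mathcal{S}r(\Gamma)$ be the category whose objects are finite sets (of registers) and whose morphisms $R\to S$ are the copyless register transitions, i.e. the maps $t:S\to(\Gamma+R)^*$ such that every $r\in R$ occurs at most once in total among the words $t(s)$, $s\in S$; the composite of $t:R\to S$ and $t':S\to T$ sends $x\in T$ to the word obtained from $t'(x)$ by replacing every register $s\in S$ by the word $t(s)$. It is symmetric monoidal with $R\otimes S=R+S$ (disjoint union) and unit $\varnothing$. For a category $\mathcal{C}$, let $\mathcal{C}_\oplus$ be its free finite coproduct completion: objects are finite families $\bigoplus_{u\in U}C_u$ of objects of $\mathcal{C}$, and $\mathrm{Hom}(\bigoplus_u C_u,\bigoplus_v D_v)=\prod_u\sum_v\mathrm{Hom}_{\mathcal{C}}(C_u,D_v)$. Let $\mathcal{C}_\&=((\mathcal{C}^{op})_\oplus)^{op}$ be its free finite product completion. Let $\mathcal{C}_{\oplus\&}$ be the category whose objects $\bigoplus_{u\in U}\&_{x\in X_u}C_{u,x}$ consist of a finite set $U$, finite sets $X_u$ and objects $C_{u,x}$ of $\mathcal{C}$, with $\mathrm{Hom}(\bigoplus_u\&_x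 C_{u,x},\bigoplus_v\&_y D_{v,y})=\prod_u\sum_v\prod_{y\in Y_v}\sum_{x\in X_u}\mathrm{Hom}_{\mathcal{C}}(C_{u,x},D_{v,y})$ and the evident composition. If $\mathcal{C}$ is symmetric monoidal, these completions carry the induced tensor products, for which $\otimes$ distributes over the formal sums and the formal products, e.g. $(\bigoplus_u\&_x C_{u,x})\otimes(\bigoplus_v\&_y D_{v,y})=\bigoplus_{(u,v)}\&_{(x,y)}C_{u,x}\otimes D_{v,y}$, and whose unit is the one-element family on the unit of $\mathcal{C}$. Theorem. The category $(\mathcal{S}r_\&)_\oplus$ is symmetric monoidal closed, and so is $\mathcal{S}r_{\oplus\&}$. Moreover, the functor $(\mathcal{S}r_\&)_\oplus\to\mathcal{S}r_{\oplus\&}$ that regards a formal sum of formal products as an object of $\mathcal{S}r_{\oplus\&}$ is an isomorphism of categories and a strong symmetric monoidal functor. -/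

import Mathlib

open CategoryTheory MonoidalCategory Opposite

universe v u

/-! ### The category `Sr(Γ)` of copyless register transitions -/

section Words

variable {Γ : Type u} {R S T U : Type}

open Classical in
/-- The number of occurrences of the register variable `r` in a word over `Γ + R`. -/
noncomputable def regOcc (r : R) (w : List (Γ ⊕ R)) : ℕ :=
  w.countP fun x => decide (x = Sum.inr r)

/-- A `Γ`-register transition `t : S → (Γ + R)*` from `R` to `S` is copyless when every register
of `R` occurs at most once among all the words `t s`, for `s` in the finite set `S`. -/
def Copyless [Finite S] (t : S → List (Γ ⊕ R)) : Prop :=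
  ∀ r : R, ∑ᶠ s : S, regOcc r (t s) ≤ 1

/-- The monoid morphism `(Γ + S)* → (Γ + R)*` that fixes the letters of `Γ` and sends each
register `s` to the word `t s`. -/
def substWord (t : S → List (Γ ⊕ R)) (w : List (Γ ⊕ S)) : List (Γ ⊕ R) :=
  w.flatMap (Sum.elim (fun c => [Sum.inl c]) t)

/-- Renaming of the registers in a word. -/
def renameWord (e : S → R) (w : List (Γ ⊕ S)) : List (Γ ⊕ R) := w.map (Sum.map id e)

@[simp] theorem substWord_nil (t : S → List (Γ ⊕ R)) : substWord t [] = [] := rfl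

@[simp] theorem substWord_inl (t : S → List (Γ ⊕ R)) (c : Γ) (w : List (Γ ⊕ S)) :
    substWord t (Sum.inl c :: w) = Sum.inl c :: substWord t w := by simp [substWord]

@[simp] theorem substWord_inr (t : S → List (Γ ⊕ R)) (s : S) (w : List (Γ ⊕ S)) :
    substWord t (Sum.inr s :: w) = t s ++ substWord t w := by simp [substWord]

theorem substWord_single (t : S → List (Γ ⊕ R)) (s : S) : substWord t [Sum.inr s] = t s := by simp

theorem substWord_append (t : S → List (Γ ⊕ R)) (w w' : List (Γ ⊕ S)) :
    substWord t (w ++ w') = substWord t w ++ substWord t w' := by simp [substWord]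

@[simp] theorem renameWord_nil (e : S → R) : renameWord (Γ := Γ) e [] = [] := rfl

@[simp] theorem renameWord_inl (e : S → R) (c : Γ) (w : List (Γ ⊕ S)) :
    renameWord e (Sum.inl c :: w) = Sum.inl c :: renameWord e w := rfl

@[simp] theorem renameWord_inr (e : S → R) (s : S) (w : List (Γ ⊕ S)) :
    renameWord e (Sum.inr s :: w) = Sum.inr (e s) :: renameWord e w := rfl

theorem renameWord_append (e : S → R) (w w' : List (Γ ⊕ S)) :
    renameWord e (w ++ w') = renameWord e w ++ renameWord e w' := by simp [renameWord]

theorem renameWord_renameWord (e : S → R) (e' : R → T) (w : List (Γ ⊕ S)) :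
    renameWord e' (renameWord e w) = renameWord (fun s => e' (e s)) w := by
  induction w with
  | nil => rfl
  | cons x w ih => cases x <;> simp [ih]

theorem substWord_var (e : S → R) (w : List (Γ ⊕ S)) :
    substWord (fun s => [Sum.inr (e s)]) w = renameWord e w := by
  induction w with
  | nil => rfl
  | cons x w ih => cases x <;> simp [ih]

theorem renameWord_id (w : List (Γ ⊕ S)) : renameWord (fun s => s) w = w := by
  induction w with
  | nil => rfl
  | cons x w ih => cases x <;> simp [ih]

theorem substWord_substWord (t : S → List (Γ ⊕ R)) (t' : T → List (Γ ⊕ S)) (w : List (Γ ⊕ T)) :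
    substWord t (substWord t' w) = substWord (fun x => substWord t (t' x)) w := by
  induction w with
  | nil => rfl
  | cons x w ih => cases x <;> simp [ih, substWord_append]

theorem substWord_renameWord (t : S → List (Γ ⊕ R)) (e : T → S) (w : List (Γ ⊕ T)) :
    substWord t (renameWord e w) = substWord (fun x => t (e x)) w := by
  induction w with
  | nil => rfl
  | cons x w ih => cases x <;> simp [ih]

theorem renameWord_substWord (e : R → U) (t : S → List (Γ ⊕ R)) (w : List (Γ ⊕ S)) :
    renameWord e (substWord t w) = substWord (fun x => renameWord e (t x)) w := by
  induction w with
  | nil => rfl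
  | cons x w ih => cases x <;> simp [ih, renameWord_append]

@[simp] theorem regOcc_nil (r : R) : regOcc (Γ := Γ) r [] = 0 := rfl

@[simp] theorem regOcc_inl (r : R) (c : Γ) (w : List (Γ ⊕ R)) :
    regOcc r (Sum.inl c :: w) = regOcc r w := by simp [regOcc]

open Classical in
@[simp] theorem regOcc_inr (r r' : R) (w : List (Γ ⊕ R)) :
    regOcc r (Sum.inr r' :: w) = regOcc r w + if r' = r then 1 else 0 := by
  simp [regOcc, List.countP_cons]

@[simp] theorem regOcc_append (r : R) (w w' : List (Γ ⊕ R)) :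
    regOcc r (w ++ w') = regOcc r w + regOcc r w' := by simp [regOcc]

theorem regOcc_substWord [Fintype S] (t : S → List (Γ ⊕ R)) (r : R) (w : List (Γ ⊕ S)) :
    regOcc r (substWord t w) = ∑ s : S, regOcc s w * regOcc r (t s) := by
  classical
  induction w with
  | nil => simp
  | cons x w ih =>
    cases x <;> simp [ih, add_mul, Finset.sum_add_distrib, add_comm]

theorem regOcc_renameWord {e : S → R} (he : Function.Injective e) (s : S) (w : List (Γ ⊕ S)) :
    regOcc (e s) (renameWord e w) = regOcc s w := by
  classical
  induction w with
  | nil => rfl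
  | cons x w ih => cases x <;> simp [ih, he.eq_iff]

theorem regOcc_renameWord_of_ne {e : S → R} {r : R} (he : ∀ s, e s ≠ r) (w : List (Γ ⊕ S)) :
    regOcc r (renameWord e w) = 0 := by
  induction w with
  | nil => rfl
  | cons x w ih => cases x <;> simp [ih, he]

theorem Copyless.subst [Finite S] [Finite T] {t : S → List (Γ ⊕ R)} {t' : T → List (Γ ⊕ S)}
    (ht : Copyless t) (ht' : Copyless t') : Copyless (fun x => substWord t (t' x)) := by
  classical
  have := Fintype.ofFinite S
  have := Fintype.ofFinite T
  intro r
  have h := ht r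
  simp only [finsum_eq_sum_of_fintype] at h ⊢
  calc ∑ x, regOcc r (substWord t (t' x))
      = ∑ s : S, (∑ x, regOcc s (t' x)) * regOcc r (t s) := by
        simp only [regOcc_substWord, Finset.sum_mul]
        exact Finset.sum_comm
    _ ≤ ∑ s : S, 1 * regOcc r (t s) := by
        refine Finset.sum_le_sum fun s _ => Nat.mul_le_mul_right _ ?_
        simpa only [finsum_eq_sum_of_fintype] using ht' s
    _ ≤ 1 := by simpa using h

theorem Copyless.rename [Finite S] {e : S → R} (he : Function.Injective e) :
    Copyless (Γ := Γ) (fun s => [Sum.inr (e s)]) := by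
  classical
  have := Fintype.ofFinite S
  intro r
  simp only [finsum_eq_sum_of_fintype, regOcc_inr, regOcc_nil, zero_add, Finset.sum_boole,
    Nat.cast_id]
  exact Finset.card_le_one.2 fun a ha b hb => he (by simp_all)

theorem Copyless.sum [Finite S] [Finite U] {t : S → List (Γ ⊕ R)} {t' : U → List (Γ ⊕ T)}
    (ht : Copyless t) (ht' : Copyless t') :
    Copyless (Sum.elim (fun s => renameWord Sum.inl (t s)) (fun s => renameWord Sum.inr (t' s)) :
      S ⊕ U → List (Γ ⊕ (R ⊕ T))) := by
  have := Fintype.ofFinite S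
  have := Fintype.ofFinite U
  rintro (r | r)
  · have h := ht r
    simp only [finsum_eq_sum_of_fintype] at h ⊢
    simpa [Fintype.sum_sum_type, regOcc_renameWord Sum.inl_injective,
      regOcc_renameWord_of_ne] using h
  · have h := ht' r
    simp only [finsum_eq_sum_of_fintype] at h ⊢
    simpa [Fintype.sum_sum_type, regOcc_renameWord Sum.inr_injective,
      regOcc_renameWord_of_ne] using h

end Words

/-- An object of `Sr(Γ)`: a finite set of registers. -/
structure Sr (Γ : Type u) where
  /-- the set of registers -/
  reg : Type
  /-- it is finite -/
  [fin : Finite reg]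

namespace Sr

attribute [instance] Sr.fin

variable {Γ : Type u}

/-- A morphism of `Sr(Γ)` from `R` to `S`: a copyless `Γ`-register transition. -/
@[ext]
structure Hom (R S : Sr Γ) where
  /-- the new content of each register of the target -/
  word : S.reg → List (Γ ⊕ R.reg)
  /-- copylessness -/
  copyless : Copyless word

/-- Identities and composition of `Sr(Γ)`: the composite of `t : R ⟶ S` and `t' : S ⟶ T`
substitutes `t` in the words of `t'`. -/
instance : Category (Sr Γ) where
  Hom R S := Hom R S
  id R := ⟨fun r => [Sum.inr r], Copyless.rename Function.injective_id⟩
  comp t t' := ⟨fun x => substWord t.word (t'.word x), t.copyless.subst t'.copyless⟩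
  id_comp t := Hom.ext (funext fun s => by
    simp only [substWord_var (fun s => s), renameWord_id])
  comp_id t := Hom.ext (funext fun s => by simp)
  assoc t t' t'' := Hom.ext (funext fun x => by simp only [substWord_substWord])

@[ext] theorem hom_ext {R S : Sr Γ} {f g : R ⟶ S} (h : ∀ s, f.word s = g.word s) : f = g :=
  Hom.ext (funext h)

@[simp] theorem id_word (R : Sr Γ) (r : R.reg) : Hom.word (𝟙 R) r = [Sum.inr r] := rfl

@[simp] theorem comp_word {R S T : Sr Γ} (f : R ⟶ S) (g : S ⟶ T) (x : T.reg) :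
    Hom.word (f ≫ g) x = substWord f.word (g.word x) := rfl

/-- The isomorphism induced by a bijective renaming of the registers. -/
def renameIso {R S : Sr Γ} (e : S.reg ≃ R.reg) : R ≅ S where
  hom := ⟨fun s => [Sum.inr (e s)], Copyless.rename e.injective⟩
  inv := ⟨fun r => [Sum.inr (e.symm r)], Copyless.rename e.symm.injective⟩
  hom_inv_id := by ext; simp
  inv_hom_id := by ext; simp

@[simp] theorem renameIso_hom_word {R S : Sr Γ} (e : S.reg ≃ R.reg) (s : S.reg) :
    Hom.word (renameIso e).hom s = [Sum.inr (e s)] := rfl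

@[simp] theorem renameIso_inv_word {R S : Sr Γ} (e : S.reg ≃ R.reg) (r : R.reg) :
    Hom.word (renameIso e).inv r = [Sum.inr (e.symm r)] := rfl

/-- The monoidal product of register transitions: act in parallel on a disjoint union. -/
def tensorMap {R S T U : Sr Γ} (t : R ⟶ S) (t' : T ⟶ U) :
    (⟨R.reg ⊕ T.reg⟩ : Sr Γ) ⟶ ⟨S.reg ⊕ U.reg⟩ :=
  ⟨Sum.elim (fun s => renameWord Sum.inl (t.word s)) (fun s => renameWord Sum.inr (t'.word s)),
    t.copyless.sum t'.copyless⟩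

@[simp] theorem tensorMap_word_inl {R S T U : Sr Γ} (t : R ⟶ S) (t' : T ⟶ U) (s : S.reg) :
    Hom.word (tensorMap t t') (Sum.inl s) = renameWord Sum.inl (t.word s) := rfl

@[simp] theorem tensorMap_word_inr {R S T U : Sr Γ} (t : R ⟶ S) (t' : T ⟶ U) (s : U.reg) :
    Hom.word (tensorMap t t') (Sum.inr s) = renameWord Sum.inr (t'.word s) := rfl

theorem tensorMap_id (R S : Sr Γ) : tensorMap (𝟙 R) (𝟙 S) = 𝟙 _ := by
  ext (s | s) <;> simp

theorem tensorMap_comp {R S T R' S' T' : Sr Γ} (f : R ⟶ S) (f' : R' ⟶ S') (g : S ⟶ T)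
    (g' : S' ⟶ T') : tensorMap f f' ≫ tensorMap g g' = tensorMap (f ≫ g) (f' ≫ g') := by
  ext (s | s) <;> simp [substWord_renameWord, renameWord_substWord]

theorem substWord_renameIso_hom {R S : Sr Γ} (e : S.reg ≃ R.reg) (w : List (Γ ⊕ S.reg)) :
    substWord (Hom.word (renameIso e).hom) w = renameWord e w := substWord_var e w

theorem tensorMap_assoc {R R' S S' T T' : Sr Γ} (f : R ⟶ R') (g : S ⟶ S') (h : T ⟶ T') :
    tensorMap (tensorMap f g) h ≫
        (renameIso (S := ⟨R'.reg ⊕ (S'.reg ⊕ T'.reg)⟩) (Equiv.sumAssoc _ _ _).symm).hom =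
      (renameIso (S := ⟨R.reg ⊕ (S.reg ⊕ T.reg)⟩) (Equiv.sumAssoc _ _ _).symm).hom ≫
        tensorMap f (tensorMap g h) := by
  apply hom_ext
  rintro (s | s | s) <;>
    refine (substWord_single _ _).trans (Eq.trans ?_ (substWord_renameIso_hom _ _).symm)
  · exact (renameWord_renameWord Sum.inl Sum.inl (f.word s)).trans (renameWord_renameWord Sum.inl
      (Equiv.sumAssoc R.reg S.reg T.reg).symm (f.word s)).symm
  · exact (renameWord_renameWord Sum.inr Sum.inl (g.word s)).trans
      ((congrArg _ (renameWord_renameWord Sum.inl Sum.inr (g.word s))).trans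
        (renameWord_renameWord _ (Equiv.sumAssoc R.reg S.reg T.reg).symm (g.word s))).symm
  · exact ((congrArg _ (renameWord_renameWord Sum.inr Sum.inr (h.word s))).trans
        (renameWord_renameWord _ (Equiv.sumAssoc R.reg S.reg T.reg).symm (h.word s))).symm

theorem tensorMap_empty_left {R S : Sr Γ} (f : R ⟶ S) :
    tensorMap (𝟙 ⟨Empty⟩) f ≫ (renameIso (Equiv.emptySum Empty S.reg).symm).hom =
      (renameIso (Equiv.emptySum Empty R.reg).symm).hom ≫ f :=
  hom_ext fun s => (substWord_single _ _).trans
    (substWord_var (Equiv.emptySum Empty R.reg).symm (f.word s)).symm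

theorem tensorMap_empty_right {R S : Sr Γ} (f : R ⟶ S) :
    tensorMap f (𝟙 ⟨Empty⟩) ≫ (renameIso (Equiv.sumEmpty S.reg Empty).symm).hom =
      (renameIso (Equiv.sumEmpty R.reg Empty).symm).hom ≫ f :=
  hom_ext fun s => (substWord_single _ _).trans
    (substWord_var (Equiv.sumEmpty R.reg Empty).symm (f.word s)).symm

theorem tensorMap_swap {R R' S S' : Sr Γ} (f : R ⟶ R') (g : S ⟶ S') :
    tensorMap f g ≫ (renameIso (S := ⟨S'.reg ⊕ R'.reg⟩) (Equiv.sumComm _ _)).hom =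
      (renameIso (S := ⟨S.reg ⊕ R.reg⟩) (Equiv.sumComm _ _)).hom ≫ tensorMap g f := by
  apply hom_ext
  rintro (s | s) <;>
    refine (substWord_single _ _).trans (Eq.trans ?_ (substWord_renameIso_hom _ _).symm)
  · exact (renameWord_renameWord Sum.inl (Equiv.sumComm S.reg R.reg) (g.word s)).symm
  · exact (renameWord_renameWord Sum.inr (Equiv.sumComm S.reg R.reg) (f.word s)).symm

/-- The monoidal product is disjoint union; the unit is the empty set of registers. -/
instance : MonoidalCategoryStruct (Sr Γ) where
  tensorObj R S := ⟨R.reg ⊕ S.reg⟩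
  tensorUnit := ⟨Empty⟩
  tensorHom f g := tensorMap f g
  whiskerLeft R _ _ f := tensorMap (𝟙 R) f
  whiskerRight f R := tensorMap f (𝟙 R)
  associator R S T := renameIso (Equiv.sumAssoc R.reg S.reg T.reg).symm
  leftUnitor R := renameIso (Equiv.emptySum Empty R.reg).symm
  rightUnitor R := renameIso (Equiv.sumEmpty R.reg Empty).symm

instance : MonoidalCategory (Sr Γ) :=
  MonoidalCategory.ofTensorHom
    (id_tensorHom_id := fun R S => tensorMap_id R S)
    (id_tensorHom := fun _ _ _ _ => rfl)
    (tensorHom_id := fun _ _ => rfl)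
    (tensorHom_comp_tensorHom := fun f f' g g' => tensorMap_comp f f' g g')
    (associator_naturality := fun f g h => tensorMap_assoc f g h)
    (leftUnitor_naturality := fun f => tensorMap_empty_left f)
    (rightUnitor_naturality := fun f => tensorMap_empty_right f)
    (pentagon := fun R S T U => by
      apply hom_ext
      rintro (s | s | s | s) <;> rfl)
    (triangle := fun R S => by
      apply hom_ext
      rintro (s | s) <;> rfl)

/-- The braiding exchanges the two components of a disjoint union. -/
instance : BraidedCategory (Sr Γ) where
  braiding R S := renameIso (Equiv.sumComm S.reg R.reg)
  braiding_naturality_right R _ _ f := tensorMap_swap (𝟙 R) f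
  braiding_naturality_left f R := tensorMap_swap f (𝟙 R)
  hexagon_forward R S T := by
    apply hom_ext
    rintro (s | s | s) <;> rfl
  hexagon_reverse R S T := by
    apply hom_ext
    rintro ((s | s) | s) <;> rfl

end Sr

/-! ### The free finite coproduct completion `C_⊕` -/

/-- An object of `C_⊕`: a finite family of objects of `C`, thought of as a formal sum. -/
structure FreeCoprod (C : Type u) where
  /-- the index set -/
  ι : Type
  /-- it is finite -/
  [fin : Finite ι]
  /-- the family of objects -/
  obj : ι → C

namespace FreeCoprod

attribute [instance] FreeCoprod.fin

variable {C : Type u} [Category.{v} C]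

/-- A morphism of `C_⊕` is an element of `∏ i, ∑ j, Hom(X i, Y j)`. -/
@[ext]
structure Hom (X Y : FreeCoprod C) where
  /-- the underlying family of pairs -/
  app : ∀ i : X.ι, Σ j : Y.ι, X.obj i ⟶ Y.obj j

/-- Identities and composition of `C_⊕`. -/
instance : Category (FreeCoprod C) where
  Hom X Y := Hom X Y
  id X := ⟨fun i => ⟨i, 𝟙 (X.obj i)⟩⟩
  comp f g := ⟨fun i => ⟨(g.app (f.app i).1).1, (f.app i).2 ≫ (g.app (f.app i).1).2⟩⟩
  id_comp _ := Hom.ext (funext fun _ => Sigma.ext rfl (heq_of_eq (Category.id_comp _)))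
  comp_id _ := Hom.ext (funext fun _ => Sigma.ext rfl (heq_of_eq (Category.comp_id _)))
  assoc _ _ _ := Hom.ext (funext fun _ => Sigma.ext rfl (heq_of_eq (Category.assoc _ _ _)))

variable [MonoidalCategory C]

/-- The monoidal structure of `C_⊕` induced by that of `C`, by distributing `⊗` over formal
sums: `(⨁ i, X i) ⊗ (⨁ j, Y j) = ⨁ (i, j), X i ⊗ Y j`. The unit is the one-element family
on the unit of `C`. -/
instance : MonoidalCategoryStruct (FreeCoprod C) where
  tensorObj X Y := ⟨X.ι × Y.ι, fun p => X.obj p.1 ⊗ Y.obj p.2⟩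
  tensorUnit := ⟨Unit, fun _ => 𝟙_ C⟩
  tensorHom f g :=
    ⟨fun p => ⟨((f.app p.1).1, (g.app p.2).1), (f.app p.1).2 ⊗ₘ (g.app p.2).2⟩⟩
  whiskerLeft X _ _ f := ⟨fun p => ⟨(p.1, (f.app p.2).1), X.obj p.1 ◁ (f.app p.2).2⟩⟩
  whiskerRight f Y := ⟨fun p => ⟨((f.app p.1).1, p.2), (f.app p.1).2 ▷ Y.obj p.2⟩⟩
  associator X Y Z :=
    { hom := ⟨fun p => ⟨(p.1.1, (p.1.2, p.2)), (α_ (X.obj p.1.1) (Y.obj p.1.2) (Z.obj p.2)).hom⟩⟩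
      inv := ⟨fun p => ⟨((p.1, p.2.1), p.2.2), (α_ (X.obj p.1) (Y.obj p.2.1) (Z.obj p.2.2)).inv⟩⟩
      hom_inv_id := Hom.ext (funext fun _ => Sigma.ext rfl (heq_of_eq (Iso.hom_inv_id _)))
      inv_hom_id := Hom.ext (funext fun _ => Sigma.ext rfl (heq_of_eq (Iso.inv_hom_id _))) }
  leftUnitor X :=
    { hom := ⟨fun p => ⟨p.2, (λ_ (X.obj p.2)).hom⟩⟩
      inv := ⟨fun i => ⟨((), i), (λ_ (X.obj i)).inv⟩⟩
      hom_inv_id := Hom.ext (funext fun _ => Sigma.ext rfl (heq_of_eq (Iso.hom_inv_id _)))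
      inv_hom_id := Hom.ext (funext fun _ => Sigma.ext rfl (heq_of_eq (Iso.inv_hom_id _))) }
  rightUnitor X :=
    { hom := ⟨fun p => ⟨p.1, (ρ_ (X.obj p.1)).hom⟩⟩
      inv := ⟨fun i => ⟨(i, ()), (ρ_ (X.obj i)).inv⟩⟩
      hom_inv_id := Hom.ext (funext fun _ => Sigma.ext rfl (heq_of_eq (Iso.hom_inv_id _)))
      inv_hom_id := Hom.ext (funext fun _ => Sigma.ext rfl (heq_of_eq (Iso.inv_hom_id _))) }

instance : MonoidalCategory (FreeCoprod C) where
  tensorHom_def _ _ :=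
    Hom.ext (funext fun _ => Sigma.ext rfl (heq_of_eq (MonoidalCategory.tensorHom_def _ _)))
  id_tensorHom_id _ _ :=
    Hom.ext (funext fun _ => Sigma.ext rfl (heq_of_eq (MonoidalCategory.id_tensorHom_id _ _)))
  tensorHom_comp_tensorHom _ _ _ _ :=
    Hom.ext (funext fun _ => Sigma.ext rfl (heq_of_eq
      (MonoidalCategory.tensorHom_comp_tensorHom _ _ _ _)))
  whiskerLeft_id _ _ :=
    Hom.ext (funext fun _ => Sigma.ext rfl (heq_of_eq (MonoidalCategory.whiskerLeft_id _ _)))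
  id_whiskerRight _ _ :=
    Hom.ext (funext fun _ => Sigma.ext rfl (heq_of_eq (MonoidalCategory.id_whiskerRight _ _)))
  associator_naturality _ _ _ :=
    Hom.ext (funext fun _ => Sigma.ext rfl (heq_of_eq
      (MonoidalCategory.associator_naturality _ _ _)))
  leftUnitor_naturality _ :=
    Hom.ext (funext fun _ => Sigma.ext rfl (heq_of_eq (MonoidalCategory.leftUnitor_naturality _)))
  rightUnitor_naturality _ :=
    Hom.ext (funext fun _ => Sigma.ext rfl (heq_of_eq (MonoidalCategory.rightUnitor_naturality _)))
  pentagon _ _ _ _ :=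
    Hom.ext (funext fun _ => Sigma.ext rfl (heq_of_eq (MonoidalCategory.pentagon _ _ _ _)))
  triangle _ _ :=
    Hom.ext (funext fun _ => Sigma.ext rfl (heq_of_eq (MonoidalCategory.triangle _ _)))

/-- The braiding of `C_⊕` induced componentwise by that of `C`. -/
instance [BraidedCategory C] : BraidedCategory (FreeCoprod C) where
  braiding X Y :=
    { hom := ⟨fun p => ⟨(p.2, p.1), (β_ (X.obj p.1) (Y.obj p.2)).hom⟩⟩
      inv := ⟨fun p => ⟨(p.2, p.1), (β_ (X.obj p.2) (Y.obj p.1)).inv⟩⟩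
      hom_inv_id := Hom.ext (funext fun _ => Sigma.ext rfl (heq_of_eq (Iso.hom_inv_id _)))
      inv_hom_id := Hom.ext (funext fun _ => Sigma.ext rfl (heq_of_eq (Iso.inv_hom_id _))) }
  braiding_naturality_right _ _ _ _ :=
    Hom.ext (funext fun _ => Sigma.ext rfl (heq_of_eq
      (BraidedCategory.braiding_naturality_right _ _)))
  braiding_naturality_left _ _ :=
    Hom.ext (funext fun _ => Sigma.ext rfl (heq_of_eq
      (BraidedCategory.braiding_naturality_left _ _)))
  hexagon_forward _ _ _ :=
    Hom.ext (funext fun _ => Sigma.ext rfl (heq_of_eq (BraidedCategory.hexagon_forward _ _ _)))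
  hexagon_reverse _ _ _ :=
    Hom.ext (funext fun _ => Sigma.ext rfl (heq_of_eq (BraidedCategory.hexagon_reverse _ _ _)))

end FreeCoprod

/-! ### The free finite product completion `C_&` -/

/-- The free finite product completion `C_& = ((Cᵒᵖ)_⊕)ᵒᵖ`. Its monoidal structure and braiding
are obtained through the same dualities, so that
`(&_x C x) ⊗ (&_y D y) = &_(x, y), C x ⊗ D y`. -/
abbrev FreeProd (C : Type u) := (FreeCoprod Cᵒᵖ)ᵒᵖ

/-! ### The category `C_⊕&` -/

/-- An object `⨁_u &_x C_(u, x)` of `C_⊕&`: a finite set `U`, a family of finite sets `X u` and a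
family of objects of `C` indexed by the pairs `(u, x)` with `x ∈ X u`. -/
structure SumProd (C : Type u) where
  /-- the index set of the sum -/
  U : Type
  /-- it is finite -/
  [finU : Finite U]
  /-- the index sets of the products -/
  X : U → Type
  /-- they are finite -/
  [finX : ∀ i, Finite (X i)]
  /-- the family of objects -/
  obj : ∀ i, X i → C

namespace SumProd

attribute [instance] SumProd.finU SumProd.finX

variable {C : Type u} [Category.{v} C]

/-- A morphism of `C_⊕&` is an element of `∏ i ∑ j ∏ y ∑ x, Hom(A (i, x), B (j, y))`. -/
@[ext]
structure Hom (A B : SumProd C) where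
  /-- the underlying family -/
  app : ∀ i : A.U, Σ j : B.U, ∀ y : B.X j, Σ x : A.X i, A.obj i x ⟶ B.obj j y

/-- Equality of elements of `∏ ∑ ∏ ∑` with definitionally equal index components. -/
theorem hom_ext' {A B : SumProd C} (e : A.U → B.U) (p : ∀ i, B.X (e i) → A.X i)
    {a b : ∀ i y, A.obj i (p i y) ⟶ B.obj (e i) y} (h : ∀ i y, a i y = b i y) :
    (⟨fun i => ⟨e i, fun y => ⟨p i y, a i y⟩⟩⟩ : Hom A B) =
      ⟨fun i => ⟨e i, fun y => ⟨p i y, b i y⟩⟩⟩ := by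
  obtain rfl : a = b := funext fun i => funext fun y => h i y
  rfl

/-- Identities and composition of `C_⊕&`. -/
instance : Category (SumProd C) where
  Hom A B := Hom A B
  id A := ⟨fun i => ⟨i, fun x => ⟨x, 𝟙 (A.obj i x)⟩⟩⟩
  comp f g := ⟨fun i => ⟨(g.app (f.app i).1).1, fun z =>
    ⟨((f.app i).2 ((g.app (f.app i).1).2 z).1).1,
      ((f.app i).2 ((g.app (f.app i).1).2 z).1).2 ≫ ((g.app (f.app i).1).2 z).2⟩⟩⟩
  id_comp _ := hom_ext' _ _ fun _ _ => Category.id_comp _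
  comp_id _ := hom_ext' _ _ fun _ _ => Category.comp_id _
  assoc _ _ _ := hom_ext' _ _ fun _ _ => Category.assoc _ _ _

variable [MonoidalCategory C]

/-- The monoidal structure of `C_⊕&` induced by that of `C`:
`(⨁_i &_x A (i, x)) ⊗ (⨁_j &_y B (j, y)) = ⨁_(i, j) &_(x, y), A (i, x) ⊗ B (j, y)`. -/
instance : MonoidalCategoryStruct (SumProd C) where
  tensorObj A B := ⟨A.U × B.U, fun p => A.X p.1 × B.X p.2, fun p q => A.obj p.1 q.1 ⊗ B.obj p.2 q.2⟩
  tensorUnit := ⟨Unit, fun _ => Unit, fun _ _ => 𝟙_ C⟩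
  tensorHom f g :=
    ⟨fun p => ⟨((f.app p.1).1, (g.app p.2).1), fun q =>
      ⟨(((f.app p.1).2 q.1).1, ((g.app p.2).2 q.2).1),
        ((f.app p.1).2 q.1).2 ⊗ₘ ((g.app p.2).2 q.2).2⟩⟩⟩
  whiskerLeft A _ _ f :=
    ⟨fun p => ⟨(p.1, (f.app p.2).1), fun q =>
      ⟨(q.1, ((f.app p.2).2 q.2).1), A.obj p.1 q.1 ◁ ((f.app p.2).2 q.2).2⟩⟩⟩
  whiskerRight f B :=
    ⟨fun p => ⟨((f.app p.1).1, p.2), fun q =>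
      ⟨(((f.app p.1).2 q.1).1, q.2), ((f.app p.1).2 q.1).2 ▷ B.obj p.2 q.2⟩⟩⟩
  associator A B D :=
    { hom := ⟨fun p => ⟨(p.1.1, (p.1.2, p.2)), fun q => ⟨((q.1, q.2.1), q.2.2),
        (α_ (A.obj p.1.1 q.1) (B.obj p.1.2 q.2.1) (D.obj p.2 q.2.2)).hom⟩⟩⟩
      inv := ⟨fun p => ⟨((p.1, p.2.1), p.2.2), fun q => ⟨(q.1.1, (q.1.2, q.2)),
        (α_ (A.obj p.1 q.1.1) (B.obj p.2.1 q.1.2) (D.obj p.2.2 q.2)).inv⟩⟩⟩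
      hom_inv_id := hom_ext' _ _ fun _ _ => Iso.hom_inv_id _
      inv_hom_id := hom_ext' _ _ fun _ _ => Iso.inv_hom_id _ }
  leftUnitor A :=
    { hom := ⟨fun p => ⟨p.2, fun x => ⟨((), x), (λ_ (A.obj p.2 x)).hom⟩⟩⟩
      inv := ⟨fun i => ⟨((), i), fun q => ⟨q.2, (λ_ (A.obj i q.2)).inv⟩⟩⟩
      hom_inv_id := hom_ext' _ _ fun _ _ => Iso.hom_inv_id _
      inv_hom_id := hom_ext' _ _ fun _ _ => Iso.inv_hom_id _ }
  rightUnitor A :=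
    { hom := ⟨fun p => ⟨p.1, fun x => ⟨(x, ()), (ρ_ (A.obj p.1 x)).hom⟩⟩⟩
      inv := ⟨fun i => ⟨(i, ()), fun q => ⟨q.1, (ρ_ (A.obj i q.1)).inv⟩⟩⟩
      hom_inv_id := hom_ext' _ _ fun _ _ => Iso.hom_inv_id _
      inv_hom_id := hom_ext' _ _ fun _ _ => Iso.inv_hom_id _ }

instance : MonoidalCategory (SumProd C) where
  tensorHom_def _ _ := hom_ext' _ _ fun _ _ => MonoidalCategory.tensorHom_def _ _
  id_tensorHom_id _ _ := hom_ext' _ _ fun _ _ => MonoidalCategory.id_tensorHom_id _ _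
  tensorHom_comp_tensorHom _ _ _ _ :=
    hom_ext' _ _ fun _ _ => MonoidalCategory.tensorHom_comp_tensorHom _ _ _ _
  whiskerLeft_id _ _ := hom_ext' _ _ fun _ _ => MonoidalCategory.whiskerLeft_id _ _
  id_whiskerRight _ _ := hom_ext' _ _ fun _ _ => MonoidalCategory.id_whiskerRight _ _
  associator_naturality _ _ _ :=
    hom_ext' _ _ fun _ _ => MonoidalCategory.associator_naturality _ _ _
  leftUnitor_naturality _ := hom_ext' _ _ fun _ _ => MonoidalCategory.leftUnitor_naturality _
  rightUnitor_naturality _ := hom_ext' _ _ fun _ _ => MonoidalCategory.rightUnitor_naturality _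
  pentagon _ _ _ _ := hom_ext' _ _ fun _ _ => MonoidalCategory.pentagon _ _ _ _
  triangle _ _ := hom_ext' _ _ fun _ _ => MonoidalCategory.triangle _ _

/-- The braiding of `C_⊕&` induced componentwise by that of `C`. -/
instance [BraidedCategory C] : BraidedCategory (SumProd C) where
  braiding A B :=
    { hom := ⟨fun p => ⟨(p.2, p.1), fun q =>
        ⟨(q.2, q.1), (β_ (A.obj p.1 q.2) (B.obj p.2 q.1)).hom⟩⟩⟩
      inv := ⟨fun p => ⟨(p.2, p.1), fun q =>
        ⟨(q.2, q.1), (β_ (A.obj p.2 q.1) (B.obj p.1 q.2)).inv⟩⟩⟩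
      hom_inv_id := hom_ext' _ _ fun _ _ => Iso.hom_inv_id _
      inv_hom_id := hom_ext' _ _ fun _ _ => Iso.inv_hom_id _ }
  braiding_naturality_right _ _ _ _ :=
    hom_ext' _ _ fun _ _ => BraidedCategory.braiding_naturality_right _ _
  braiding_naturality_left _ _ :=
    hom_ext' _ _ fun _ _ => BraidedCategory.braiding_naturality_left _ _
  hexagon_forward _ _ _ := hom_ext' _ _ fun _ _ => BraidedCategory.hexagon_forward _ _ _
  hexagon_reverse _ _ _ := hom_ext' _ _ fun _ _ => BraidedCategory.hexagon_reverse _ _ _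

end SumProd

/-- The functor `(C_&)_⊕ ⥤ C_⊕&` that unfolds a formal sum of formal products. -/
def unfoldFunctor (C : Type u) [Category.{v} C] : FreeCoprod (FreeProd C) ⥤ SumProd C where
  obj A := ⟨A.ι, fun i => (A.obj i).unop.ι, fun i x => ((A.obj i).unop.obj x).unop⟩
  map f := ⟨fun i => ⟨(f.app i).1, fun y =>
    ⟨((f.app i).2.unop.app y).1, ((f.app i).2.unop.app y).2.unop⟩⟩⟩
  map_id _ := rfl
  map_comp _ _ := rfl

/-- A category equipped with a monoidal structure and a braiding is symmetric monoidal closed when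
the braiding is a symmetry and the category has all internal homs. -/
structure IsSymmetricMonoidalClosed (C : Type u) [Category.{v} C] [MonoidalCategory C]
    [BraidedCategory C] : Prop where
  /-- the braiding is a symmetry -/
  symm : ∀ X Y : C, (β_ X Y).hom ≫ (β_ Y X).hom = 𝟙 (X ⊗ Y)
  /-- tensoring with any object has a right adjoint -/
  closed : Nonempty (MonoidalClosed C)

/-!
# Symmetric monoidal closure of the sum-product completions of `Sr(Γ)`

A copyless transition `R ⊗ T ⟶ S` assigns to each `s` a word over `Γ + R + T`. Such a word is
uniquely of the form `b₀ r₁ b₁ … rₙ bₙ` with `rᵢ ∈ R` and `bᵢ` a word over `Γ + T`, and the transition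
is copyless if and only if the families of the `rᵢ` and of the `bᵢ` are (`copyless_interleave_iff`).
The lists `r₁ … rₙ` form a skeleton, and there are finitely many of them because `R` and `S` are
finite and no register is repeated; the words `bᵢ` form a transition from `T` to the set of blocks of
the skeleton. Hence `Hom(R ⊗ T, S) ≃ ∑_σ Hom(T, blocks σ)`, naturally in `T`
(`Sr.Skeleton.whiskerLeft_ev_bijective`): two objects of `Sr(Γ)` have an internal hom `⨁_σ blocks σ`
in `Sr(Γ)_⊕`.

For any monoidal category `C` whose objects have internal homs in `C_⊕`, the category `C_⊕&` is
closed. Indeed a morphism `A ⊗ T ⟶ B` is an element of a product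
`∏_w ∏_u ∑_v ∏_y ∑_(x, z) Hom(A (u, x) ⊗ T (w, z), B (v, y))`; inserting the internal homs of objects
of `C` and distributing products over sums turns it into `∏_w ∑_F ∏_(u, y) ∑_z Hom(T (w, z), -)`,
where `F` ranges over the finite set of choice functions. This is the set of morphisms from `T` to
`⨁_F &_(u, y)` of the blocks chosen by `F` (`SumProd.uncurryEquiv`).

The functor from `(C_&)_⊕` to `C_⊕&` only unfolds opposites, so it has a strict inverse and preserves
the tensor product and the braiding on the nose; closure of `(C_&)_⊕` follows by transport.
-/

/-! ### The unfolding functor -/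

section Unfold

variable {C : Type u} [Category.{v} C]

/-- The inverse of `unfoldFunctor`: a two-level family is read as a formal sum of formal products. -/
def foldFunctor (C : Type u) [Category.{v} C] : SumProd C ⥤ FreeCoprod (FreeProd C) where
  obj A := ⟨A.U, fun i => op ⟨A.X i, fun x => op (A.obj i x)⟩⟩
  map f := ⟨fun i => ⟨(f.app i).1, Quiver.Hom.op
    ⟨fun y => ⟨((f.app i).2 y).1, ((f.app i).2 y).2.op⟩⟩⟩⟩
  map_id _ := rfl
  map_comp _ _ := rfl

theorem unfoldFunctor_comp_foldFunctor : unfoldFunctor C ⋙ foldFunctor C = 𝟭 _ := rfl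

theorem foldFunctor_comp_unfoldFunctor : foldFunctor C ⋙ unfoldFunctor C = 𝟭 _ := rfl

instance : (unfoldFunctor C).IsEquivalence :=
  (CategoryTheory.Equivalence.mk (unfoldFunctor C) (foldFunctor C)
    (Iso.refl _) (Iso.refl _)).isEquivalence_functor

variable [MonoidalCategory C]

/-- The functor `unfoldFunctor C` is strictly monoidal: unit and tensor products are preserved
definitionally, so the coherence isomorphisms are identities. -/
instance unfoldFunctorMonoidal : (unfoldFunctor C).Monoidal :=
  Functor.CoreMonoidal.toMonoidal
    { εIso := Iso.refl (𝟙_ (SumProd C))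
      μIso := fun A B => Iso.refl ((unfoldFunctor C).obj A ⊗ (unfoldFunctor C).obj B)
      μIso_hom_natural_left := fun _ _ => (Category.comp_id _).trans (Category.id_comp _).symm
      μIso_hom_natural_right := fun _ _ => (Category.comp_id _).trans (Category.id_comp _).symm
      associativity := fun A B D =>
        have h (X Y Z : SumProd C) :
            𝟙 (X ⊗ Y) ▷ Z ≫ 𝟙 _ ≫ (α_ X Y Z).hom = (α_ X Y Z).hom ≫ X ◁ 𝟙 (Y ⊗ Z) ≫ 𝟙 _ := by simp
        h ((unfoldFunctor C).obj A) ((unfoldFunctor C).obj B) ((unfoldFunctor C).obj D)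
      left_unitality := fun A =>
        have h (X : SumProd C) : (λ_ X).hom = 𝟙 (𝟙_ (SumProd C)) ▷ X ≫ 𝟙 _ ≫ (λ_ X).hom := by simp
        h ((unfoldFunctor C).obj A)
      right_unitality := fun A =>
        have h (X : SumProd C) : (ρ_ X).hom = X ◁ 𝟙 (𝟙_ (SumProd C)) ≫ 𝟙 _ ≫ (ρ_ X).hom := by simp
        h ((unfoldFunctor C).obj A) }

instance unfoldFunctorBraided [BraidedCategory C] : (unfoldFunctor C).Braided where
  braided X Y :=
    have h (A B : SumProd C) : 𝟙 (A ⊗ B) ≫ (β_ A B).hom = (β_ A B).hom ≫ 𝟙 (B ⊗ A) := by simp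
    h ((unfoldFunctor C).obj X) ((unfoldFunctor C).obj Y)

theorem SumProd.braiding_symm [BraidedCategory C]
    (h : ∀ X Y : C, (β_ X Y).hom ≫ (β_ Y X).hom = 𝟙 (X ⊗ Y)) (A B : SumProd C) :
    (β_ A B).hom ≫ (β_ B A).hom = 𝟙 (A ⊗ B) :=
  hom_ext' _ _ fun _ _ => h _ _

/-- The structure of `C_⊕&` transfers to `(C_&)_⊕` along the isomorphism `unfoldFunctor C`. -/
theorem IsSymmetricMonoidalClosed.freeCoprod_freeProd [BraidedCategory C]
    (h : IsSymmetricMonoidalClosed (SumProd C)) :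
    IsSymmetricMonoidalClosed (FreeCoprod (FreeProd C)) where
  -- `unfoldFunctor C` sends the two sides to the corresponding morphisms of `C_⊕&` definitionally.
  symm X Y := (unfoldFunctor C).map_injective
    (h.symm ((unfoldFunctor C).obj X) ((unfoldFunctor C).obj Y))
  closed := h.closed.map fun (_ : MonoidalClosed (SumProd C)) =>
    MonoidalClosed.ofEquiv (unfoldFunctor C) (unfoldFunctor C).asEquivalence.toAdjunction

end Unfold

/-! ### Internal homs from universal arrows -/

/-- A monoidal category is closed as soon as every pair `A`, `B` admits a universal arrow
`A ⊗ H A B ⟶ B`; no functoriality of `H` has to be checked. -/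
theorem CategoryTheory.MonoidalClosed.nonempty_of_bijective
    {C : Type u} [Category.{v} C] [MonoidalCategory C]
    (H : C → C → C) (ev : ∀ A B, A ⊗ H A B ⟶ B)
    (h : ∀ A B T, Function.Bijective fun g : T ⟶ H A B => A ◁ g ≫ ev A B) :
    Nonempty (MonoidalClosed C) :=
  ⟨{ closed := fun A =>
      { rightAdj := _
        adj := Adjunction.adjunctionOfEquivRight (F := tensorLeft A) (G_obj := H A)
          (fun T B => (Equiv.ofBijective _ (h A B T)).symm) (by
            intro T' T B f g
            rw [Equiv.symm_apply_eq]
            have := (Equiv.ofBijective _ (h A B T)).apply_symm_apply g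
            simp only [Equiv.ofBijective_apply] at this ⊢
            simp [this]) } }⟩

/-- An internal hom of two objects `R`, `S` of `C` that lives in `C_⊕` rather than in `C`: a finite
family of objects `obj i` with arrows `R ⊗ obj i ⟶ S` such that every arrow `R ⊗ T ⟶ S` factors
through exactly one of them, in a unique way. -/
structure SumHom {C : Type u} [Category.{v} C] [MonoidalCategory C] (R S : C) where
  /-- the index set of the formal sum -/
  ι : Type
  /-- it is finite -/
  [fin : Finite ι]
  /-- the summands -/
  obj : ι → C
  /-- the evaluation on each summand -/
  ev : ∀ i, R ⊗ obj i ⟶ S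
  /-- the evaluations are jointly universal -/
  bij : ∀ T, Function.Bijective fun p : Σ i, T ⟶ obj i => R ◁ p.2 ≫ ev p.1

namespace SumHom

attribute [instance] SumHom.fin

variable {C : Type u} [Category.{v} C] [MonoidalCategory C]

/-- Uncurrying: `∑ i, Hom(T, obj i) ≃ Hom(R ⊗ T, S)`. -/
noncomputable def equiv {R S : C} (h : SumHom R S) (T : C) : (Σ i, T ⟶ h.obj i) ≃ (R ⊗ T ⟶ S) :=
  Equiv.ofBijective _ (h.bij T)

end SumHom

namespace SumProd

variable {C : Type u} [Category.{v} C] [MonoidalCategory C]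

/-- The internal hom of `C_⊕&`, given internal homs `R ⊸ S = ⨁_i (R ⊸ S)_i` of objects of `C` with
values in `C_⊕`. It is obtained by distributing the products of
`∏_u ∑_v ∏_y ∑_x ∑_i Hom(-, (A (u, x) ⊸ B (v, y))_i)` over the sums: an index of the outer sum is a
choice function, and the formal product over `u` and `y` remains. -/
def ihomObj (h : ∀ R S : C, SumHom R S) (A B : SumProd C) : SumProd C where
  U := ∀ u : A.U, Σ v : B.U, ∀ y : B.X v, Σ x : A.X u, (h (A.obj u x) (B.obj v y)).ι
  X F := Σ u : A.U, B.X (F u).1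
  obj F q := (h _ _).obj ((F q.1).2 q.2).2

/-- The evaluation `A ⊗ (A ⊸ B) ⟶ B` of `C_⊕&`: at a summand `u` of `A` and a choice function `F`,
follow the choices of `F` and project on the factors `(u, y)`. -/
def ihomEv (h : ∀ R S : C, SumHom R S) (A B : SumProd C) : A ⊗ ihomObj h A B ⟶ B :=
  Hom.mk fun p => ⟨(p.2 p.1).1, fun y => ⟨(((p.2 p.1).2 y).1, ⟨p.1, y⟩), (h _ _).ev _⟩⟩

/-- Uncurrying in `C_⊕&`, as a composite of distributivity bijections and uncurryings in `C`. -/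
noncomputable def uncurryEquiv (h : ∀ R S : C, SumHom R S) (A B T : SumProd C) :
    (T ⟶ ihomObj h A B) ≃ (A ⊗ T ⟶ B) :=
  -- Uncurrying at a fixed pair of summands `u` of `A` and `w` of `T`.
  let step (w : T.U) (u : A.U) :
      (Σ v : B.U, ∀ y : B.X v, Σ x : A.X u, Σ i : (h (A.obj u x) (B.obj v y)).ι, Σ z : T.X w,
        T.obj w z ⟶ (h (A.obj u x) (B.obj v y)).obj i) ≃
      (Σ v : B.U, ∀ y : B.X v, Σ q : A.X u × T.X w, A.obj u q.1 ⊗ T.obj w q.2 ⟶ B.obj v y) :=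
    Equiv.sigmaCongrRight fun v => Equiv.piCongrRight fun y =>
      (Equiv.sigmaCongrRight fun x =>
        (⟨fun p => ⟨p.2.1, p.1, p.2.2⟩, fun p => ⟨p.2.1, p.1, p.2.2⟩,
          fun _ => rfl, fun _ => rfl⟩ : _ ≃ Σ z : T.X w, Σ i, T.obj w z ⟶ (h _ _).obj i).trans
        (Equiv.sigmaCongrRight fun z => (h (A.obj u x) (B.obj v y)).equiv (T.obj w z))).trans
      ⟨fun p => ⟨(p.1, p.2.1), p.2.2⟩, fun p => ⟨p.1.1, p.1.2, p.2⟩, fun _ => rfl, fun _ => rfl⟩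
  -- Distributivity of products over sums: a choice function together with a family indexed by the
  -- choices amounts to a family of dependent pairs.
  (⟨fun g w u => ⟨((g.app w).1 u).1, fun y => ⟨(((g.app w).1 u).2 y).1, (((g.app w).1 u).2 y).2,
      (g.app w).2 ⟨u, y⟩⟩⟩,
    fun D => ⟨fun w => ⟨fun u => ⟨(D w u).1, fun y => ⟨((D w u).2 y).1, ((D w u).2 y).2.1⟩⟩,
      fun q => ((D w q.1).2 q.2).2.2⟩⟩, fun _ => rfl, fun _ => rfl⟩ :
    (T ⟶ ihomObj h A B) ≃ ∀ (w : T.U) (u : A.U), Σ v : B.U, ∀ y : B.X v, Σ x : A.X u,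
      Σ i : (h (A.obj u x) (B.obj v y)).ι, Σ z : T.X w,
        T.obj w z ⟶ (h (A.obj u x) (B.obj v y)).obj i).trans
  ((Equiv.piCongrRight fun w => Equiv.piCongrRight fun u => step w u).trans
    ⟨fun E => ⟨fun p => E p.2 p.1⟩, fun f w u => f.app (u, w), fun _ => rfl, fun _ => rfl⟩)

theorem uncurryEquiv_apply (h : ∀ R S : C, SumHom R S) (A B T : SumProd C)
    (g : T ⟶ ihomObj h A B) :
    uncurryEquiv h A B T g = A ◁ g ≫ ihomEv h A B := rfl

theorem nonempty_monoidalClosed (h : ∀ R S : C, SumHom R S) :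
    Nonempty (MonoidalClosed (SumProd C)) :=
  MonoidalClosed.nonempty_of_bijective (ihomObj h) (ihomEv h) fun A B T =>
    funext (uncurryEquiv_apply h A B T) ▸ (uncurryEquiv h A B T).bijective

end SumProd

/-! ### Words with one distinguished set of registers -/

section Interleave

variable {Γ : Type u} {R S T U : Type}

/-- The word `b₀ r₁ b₁ … rₙ bₙ` obtained by interleaving a list `r₁ … rₙ` of registers of `R` with
`n + 1` words over `Γ + T`. -/
def interleave : (l : List R) → (Fin (l.length + 1) → List (Γ ⊕ T)) → List (Γ ⊕ (R ⊕ T))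
  | [], b => renameWord Sum.inr (b 0)
  | r :: l, b =>
    renameWord Sum.inr (b 0) ++ Sum.inr (Sum.inl r) :: interleave l fun i => b i.succ

theorem regOcc_inl_interleave (r : R) (l : List R) (b : Fin (l.length + 1) → List (Γ ⊕ T)) :
    regOcc (Sum.inl r) (interleave l b) = regOcc (Γ := Γ) r (l.map Sum.inr) := by
  induction l with
  | nil => simp [interleave, regOcc_renameWord_of_ne]
  | cons r' l ih => by_cases h : r' = r <;> simp [interleave, regOcc_renameWord_of_ne, ih, h]

theorem regOcc_inr_interleave (t : T) (l : List R) (b : Fin (l.length + 1) → List (Γ ⊕ T)) :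
    regOcc (Sum.inr t) (interleave l b) = ∑ i, regOcc t (b i) := by
  induction l with
  | nil => simp [interleave, regOcc_renameWord Sum.inr_injective]
  | cons r' l ih =>
    refine Eq.trans ?_ (Fin.sum_univ_succ fun i : Fin (l.length + 1 + 1) => regOcc t (b i)).symm
    simp [interleave, regOcc_renameWord Sum.inr_injective, ih]

theorem copyless_interleave_iff [Finite S] {l : S → List R}
    {b : ∀ s, Fin ((l s).length + 1) → List (Γ ⊕ T)} :
    Copyless (fun s => interleave (l s) (b s)) ↔
      Copyless (Γ := Γ) (fun s => (l s).map Sum.inr) ∧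
        Copyless fun x : Σ s, Fin ((l s).length + 1) => b x.1 x.2 := by
  have := Fintype.ofFinite S
  simp only [Copyless, Sum.forall, regOcc_inl_interleave, regOcc_inr_interleave,
    finsum_eq_sum_of_fintype, Fintype.sum_sigma]

theorem substWord_interleave {t : R ⊕ U → List (Γ ⊕ (R ⊕ T))} {g : U → List (Γ ⊕ T)}
    (hl : ∀ r, t (Sum.inl r) = [Sum.inr (Sum.inl r)])
    (hr : ∀ x, t (Sum.inr x) = renameWord Sum.inr (g x))
    (l : List R) (b : Fin (l.length + 1) → List (Γ ⊕ U)) :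
    substWord t (interleave l b) = interleave l fun i => substWord g (b i) := by
  induction l with
  | nil => simp [interleave, substWord_renameWord, renameWord_substWord, hr]
  | cons r l ih =>
    simp [interleave, substWord_renameWord, renameWord_substWord, substWord_append, hl, hr, ih]

theorem renameWord_inr_injective :
    Function.Injective (renameWord Sum.inr : List (Γ ⊕ T) → List (Γ ⊕ (R ⊕ T))) :=
  List.map_injective_iff.2 (Sum.map_injective.2 ⟨Function.injective_id, Sum.inr_injective⟩)

theorem renameWord_inr_append_inl_inj {w w' : List (Γ ⊕ T)} {r r' : R}
    {x x' : List (Γ ⊕ (R ⊕ T))}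
    (h : renameWord Sum.inr w ++ Sum.inr (Sum.inl r) :: x =
      renameWord Sum.inr w' ++ Sum.inr (Sum.inl r') :: x') : w = w' ∧ r = r' ∧ x = x' := by
  induction w generalizing w' with
  | nil => rcases w' with _ | ⟨_ | _, w'⟩ <;> simp_all
  | cons a w ih =>
    rcases a with a | a <;> rcases w' with _ | ⟨_ | _, w'⟩ <;> simp at h <;>
      exact ⟨by rw [h.1, (ih h.2).1], (ih h.2).2⟩

theorem renameWord_inr_ne_append_inl (w w' : List (Γ ⊕ T)) (r : R) (x : List (Γ ⊕ (R ⊕ T))) :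
    renameWord Sum.inr w ≠ renameWord Sum.inr w' ++ Sum.inr (Sum.inl r) :: x := fun h => by
  have h' := congrArg (regOcc (Sum.inl r)) h
  simp [regOcc_renameWord_of_ne] at h'

/-- The list and the words `b₀, …, bₙ` can be read off an interleaving. The conclusion is an equality
of dependent pairs since the type of the family of words depends on the list. -/
theorem interleave_injective {l l' : List R} {b : Fin (l.length + 1) → List (Γ ⊕ T)}
    {b' : Fin (l'.length + 1) → List (Γ ⊕ T)} (h : interleave l b = interleave l' b') :
    (⟨l, b⟩ : Σ l : List R, Fin (l.length + 1) → List (Γ ⊕ T)) = ⟨l', b'⟩ := by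
  induction l generalizing l' with
  | nil =>
    cases l' with
    | nil =>
      have h0 := renameWord_inr_injective h
      exact congrArg (Sigma.mk []) (funext fun i => by rwa [Fin.fin_one_eq_zero i])
    | cons r l' => exact (renameWord_inr_ne_append_inl _ _ _ _ h).elim
  | cons r l ih =>
    cases l' with
    | nil => exact (renameWord_inr_ne_append_inl _ _ _ _ h.symm).elim
    | cons r' l' =>
      obtain ⟨h0, rfl, h⟩ := renameWord_inr_append_inl_inj h
      obtain ⟨rfl, hb⟩ := Sigma.mk.inj (ih h)
      refine congrArg (Sigma.mk _) (funext fun i => ?_)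
      exact Fin.cases h0 (fun i => congrFun (eq_of_heq hb) i) i

theorem exists_interleave_eq (w : List (Γ ⊕ (R ⊕ T))) :
    ∃ (l : List R) (b : Fin (l.length + 1) → List (Γ ⊕ T)), interleave l b = w := by
  induction w with
  | nil => exact ⟨[], fun _ => [], rfl⟩
  | cons a w ih =>
    obtain ⟨l, b, rfl⟩ := ih
    -- Prefixing a word with a symbol outside `R` extends the first block.
    have letter (x : Γ ⊕ T) : ∃ (l' : List R) (b' : Fin (l'.length + 1) → List (Γ ⊕ T)),
        interleave l' b' = Sum.map id Sum.inr x :: interleave l b := by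
      cases l with
      | nil => exact ⟨[], fun _ => x :: b 0, rfl⟩
      | cons r l => exact ⟨r :: l, Fin.cons (x :: b 0) fun i => b i.succ, rfl⟩
    rcases a with c | r | t
    · exact letter (Sum.inl c)
    · exact ⟨r :: l, Fin.cons [] b, rfl⟩
    · exact letter (Sum.inr t)

end Interleave

/-! ### Internal homs of register sets -/

namespace Sr

variable {Γ : Type u}

/-- What remains of the words of a copyless transition `R ⊗ T ⟶ S` when everything but the registers
of `R` is erased. Copylessness over `Γ`, for words without letters, expresses that each register
occurs at most once in total. -/
def Skeleton (R S : Sr Γ) : Type :=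
  {σ : S.reg → List R.reg // Copyless (Γ := Γ) fun s => (σ s).map Sum.inr}

theorem nodup_of_regOcc_le_one {R : Type} {l : List R}
    (h : ∀ r, regOcc (Γ := Γ) r (l.map Sum.inr) ≤ 1) : l.Nodup := by
  classical
  refine List.nodup_iff_count_le_one.2 fun r => le_trans (le_of_eq ?_) (h r)
  clear h
  induction l with
  | nil => rfl
  | cons r' l ih => simp [List.count_cons, ih]

theorem Skeleton.nodup {R S : Sr Γ} (σ : Skeleton R S) (s : S.reg) : (σ.1 s).Nodup := by
  have := Fintype.ofFinite S.reg
  refine nodup_of_regOcc_le_one (Γ := Γ) fun r => le_trans ?_ (σ.2 r)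
  rw [finsum_eq_sum_of_fintype]
  exact Finset.single_le_sum (f := fun s => regOcc (Γ := Γ) r ((σ.1 s).map Sum.inr))
    (fun _ _ => Nat.zero_le _) (Finset.mem_univ s)

/-- There are finitely many skeletons, since each word of a skeleton is a list without repetitions of
elements of a finite set. -/
instance (R S : Sr Γ) : Finite (Skeleton R S) := by
  classical
  have := Fintype.ofFinite R.reg
  exact Finite.of_injective
    (fun (σ : Skeleton R S) s => (⟨σ.1 s, σ.nodup s⟩ : {l : List R.reg // l.Nodup}))
    fun σ τ h => Subtype.ext (funext fun s => congrArg Subtype.val (congrFun h s))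

/-- The set with one register for each of the `n + 1` blocks that surround the `n` registers of the
word `σ s`, for each `s`. -/
def Skeleton.blocks {R S : Sr Γ} (σ : Skeleton R S) : Sr Γ :=
  ⟨Σ s : S.reg, Fin ((σ.1 s).length + 1)⟩

/-- The transition that restores the words of `S` from a skeleton and the contents of its blocks. -/
def Skeleton.ev {R S : Sr Γ} (σ : Skeleton R S) : R ⊗ σ.blocks ⟶ S :=
  Hom.mk (fun s => interleave (σ.1 s) fun i => [Sum.inr ⟨s, i⟩])
    (copyless_interleave_iff.2 ⟨σ.2, Copyless.rename Function.injective_id⟩)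

theorem Skeleton.whiskerLeft_ev_word {R S T : Sr Γ} (σ : Skeleton R S) (g : T ⟶ σ.blocks)
    (s : S.reg) : (R ◁ g ≫ σ.ev).word s = interleave (σ.1 s) fun i => g.word ⟨s, i⟩ := by
  refine (substWord_interleave (g := g.word) (fun _ => rfl) (fun _ => rfl) _ _).trans ?_
  exact congrArg _ (funext fun i => substWord_single g.word _)

/-- A transition `R ⊗ T ⟶ S` amounts to a skeleton together with a copyless filling of its blocks by
words over `Γ + T`. -/
theorem Skeleton.whiskerLeft_ev_bijective (R S T : Sr Γ) :
    Function.Bijective fun p : Σ σ : Skeleton R S, T ⟶ σ.blocks => R ◁ p.2 ≫ p.1.ev := by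
  constructor
  · rintro ⟨σ, g⟩ ⟨τ, g'⟩ h
    have h' (s : S.reg) := interleave_injective <|
      (σ.whiskerLeft_ev_word g s).symm.trans <|
        (congrArg (fun f : R ⊗ T ⟶ S => f.word s) h).trans (τ.whiskerLeft_ev_word g' s)
    obtain rfl : σ = τ := Subtype.ext (funext fun s => congrArg Sigma.fst (h' s))
    refine congrArg (Sigma.mk σ) (hom_ext ?_)
    rintro ⟨s, i⟩
    exact congrFun (sigma_mk_injective (h' s)) i
  · rintro ⟨w, hw⟩
    choose l b hlb using fun s => exists_interleave_eq (w s)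
    obtain rfl : (fun s => interleave (l s) (b s)) = w := funext hlb
    let σ : Skeleton R S := ⟨l, (copyless_interleave_iff.1 hw).1⟩
    let g : T ⟶ σ.blocks := Hom.mk (fun x => b x.1 x.2) (copyless_interleave_iff.1 hw).2
    exact ⟨⟨σ, g⟩, hom_ext (σ.whiskerLeft_ev_word g)⟩

/-- The internal hom `R ⊸ S = ⨁_σ blocks σ` with values in `Sr(Γ)_⊕`. -/
def sumHom (R S : Sr Γ) : SumHom R S where
  ι := Skeleton R S
  obj := Skeleton.blocks
  ev := Skeleton.ev
  bij := Skeleton.whiskerLeft_ev_bijective R S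

theorem isSymmetricMonoidalClosed_sumProd (Γ : Type u) :
    IsSymmetricMonoidalClosed (SumProd (Sr Γ)) where
  symm := SumProd.braiding_symm fun R S => hom_ext (by rintro (s | s) <;> rfl)
  closed := SumProd.nonempty_monoidalClosed sumHom

end Sr

theorem theorem1p3 (Γ : Type u) [Finite Γ] :
    IsSymmetricMonoidalClosed (FreeCoprod (FreeProd (Sr Γ))) ∧
    IsSymmetricMonoidalClosed (SumProd (Sr Γ)) ∧
    (∃ G : SumProd (Sr Γ) ⥤ FreeCoprod (FreeProd (Sr Γ)),
      unfoldFunctor (Sr Γ) ⋙ G = 𝟭 _ ∧ G ⋙ unfoldFunctor (Sr Γ) = 𝟭 _) ∧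
    Nonempty (unfoldFunctor (Sr Γ)).Braided :=
  ⟨(Sr.isSymmetricMonoidalClosed_sumProd Γ).freeCoprod_freeProd,
    Sr.isSymmetricMonoidalClosed_sumProd Γ,
    ⟨foldFunctor _, unfoldFunctor_comp_foldFunctor, foldFunctor_comp_unfoldFunctor⟩,
    ⟨inferInstance⟩⟩
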